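/- For a real number $r$, let $\mathcal{A}_r$ be the class of multiplicative functions $f:\mathbb{N}\to\mathbb{C}$, $\mathbb{N}=\{1,2,\ldots\}$, for which there are real constants $C_1,C_2$ such that $|f(p)-p^r|\le C_1p^{r-1/2}$ for every prime $p$ and $|f(p^\nu)|\le C_2p^{\nu r}$ for every prime $p$ and every integer $\nu\ge 2$. Let $k\ge 2$ be an integer and let $f\in\mathcal{A}_0$. Then the product $$E_{f,k}=\prod_p\left(1-\frac1p\right)^k\sum_{\nu_1,\ldots,\nu_k=0}^{\infty}\frac{f(p^{\max(\nu_1,\ldots,\nu_k)})}{p^{\nu_1+\cdots+\nu_k}}$$ over all primes $p$ (each whole factor, including the sum, being under the product sign) and all the series in it converge unconditionally, i.e. to values independent of the order of their factors and terms, and for every $\varepsilon>0$ and all real $x\ge 1$, $$\sum_{\substack{n_1,\ldots,n_k\in\mathbb{N}\\ n_1^2+\cdots+n_k^2\le x}} f([n_1,\ldots,n_k])=\frac{V_kE_{f,k}}{2^k}\,x^{k/2}+O\left(x^{k/2-1/4+\varepsilon}\right),$$ where $[n_1,\ldots,n_k]$ is the least common multiple, $V_k=\pi^{k/2}/\Gamma(k/2+1)$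 is the volume of the $k$-dimensional unit ball, and the implied constant depends only on $f$, $k$ and $\varepsilon$. -/

import Mathlib

namespace SphericalLCM

/-- The class `𝒜_r`: multiplicative arithmetic functions `f : ℕ → ℂ` for which there are real
constants `C₁`, `C₂` with `|f(p) - p ^ r| ≤ C₁ p ^ (r - 1/2)` for all primes `p` and
`|f(p ^ ν)| ≤ C₂ p ^ (ν r)` for all prime powers `p ^ ν` with `ν ≥ 2`. -/
structure ClassA (r : ℝ) (f : ArithmeticFunction ℂ) : Prop where
  isMultiplicative : f.IsMultiplicative
  bound_prime : ∃ C₁ : ℝ, ∀ p : ℕ, p.Prime →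
    ‖f p - (((p : ℝ) ^ r : ℝ) : ℂ)‖ ≤ C₁ * (p : ℝ) ^ (r - 1 / 2)
  bound_prime_pow : ∃ C₂ : ℝ, ∀ p ν : ℕ, p.Prime → 2 ≤ ν →
    ‖f (p ^ ν)‖ ≤ C₂ * (p : ℝ) ^ ((ν : ℝ) * r)

/-- The `k`-tuples of positive integers with `n₁² + ⋯ + n_k² ≤ x`. The bound `n_i ≤ ⌊x⌋` only
serves to make the set visibly finite; see `mem_sphericalPoints`. -/
noncomputable def sphericalPoints (k : ℕ) (x : ℝ) : Finset (Fin k → ℕ) :=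
  {n ∈ Fintype.piFinset fun _ : Fin k => Finset.Icc 1 ⌊x⌋₊ | ∑ i, (n i : ℝ) ^ 2 ≤ x}

theorem mem_sphericalPoints {k : ℕ} {x : ℝ} {n : Fin k → ℕ} :
    n ∈ sphericalPoints k x ↔ (∀ i, 1 ≤ n i) ∧ ∑ i, (n i : ℝ) ^ 2 ≤ x := by
  simp only [sphericalPoints, Finset.mem_filter, Fintype.mem_piFinset, Finset.mem_Icc]
  constructor
  · rintro ⟨h, hx⟩
    exact ⟨fun i => (h i).1, hx⟩
  · rintro ⟨h, hx⟩
    refine ⟨fun i => ⟨h i, Nat.le_floor ?_⟩, hx⟩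
    have h1 : (1 : ℝ) ≤ n i := by exact_mod_cast h i
    have h2 : (n i : ℝ) ^ 2 ≤ ∑ j, (n j : ℝ) ^ 2 :=
      Finset.single_le_sum (f := fun j => (n j : ℝ) ^ 2) (fun j _ => sq_nonneg _)
        (Finset.mem_univ i)
    nlinarith

/-- `V_k = π ^ (k/2) / Γ(k/2 + 1)`, the volume of the `k`-dimensional unit ball. -/
noncomputable def ballVolume (k : ℕ) : ℝ :=
  Real.pi ^ ((k : ℝ) / 2) / Real.Gamma ((k : ℝ) / 2 + 1)

/-- The term `f(p ^ max(ν₁, …, ν_k)) / p ^ (ν₁ + ⋯ + ν_k)` of the local series at `p`. -/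
noncomputable def localTerm (f : ArithmeticFunction ℂ) (k p : ℕ) (ν : Fin k → ℕ) : ℂ :=
  f (p ^ Finset.univ.sup ν) / (p : ℂ) ^ ∑ i, ν i

/-- The local factor `(1 - 1/p) ^ k * ∑_{ν₁, …, ν_k ≥ 0} f(p ^ max ν) / p ^ (ν₁ + ⋯ + ν_k)`. -/
noncomputable def localFactor (f : ArithmeticFunction ℂ) (k p : ℕ) : ℂ :=
  (1 - 1 / (p : ℂ)) ^ k * ∑' ν : Fin k → ℕ, localTerm f k p ν

/-- The constant `E_{f,k}`, the Euler product of the local factors. -/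
noncomputable def eulerConst (f : ArithmeticFunction ℂ) (k : ℕ) : ℂ :=
  ∏' p : Nat.Primes, localFactor f k p

end SphericalLCM

open Finset ArithmeticFunction MeasureTheory

namespace SphericalLCM


/-! Write `F(n) = f([n₁, …, n_k])` as the sum of `G(d)` over coordinatewise divisors `d` of `n`,
with `G` the Möbius transform of `F`. The sum over the ball becomes `∑_d G(d) N_d(x)`, where
`N_d(x)` counts its points with `dᵢ ∣ nᵢ` (`hasSum_divCount`).

Two facts finish the proof. Since `G` is multiplicative and equals `f(p) - 1 = O(p^(-1/2))` on
tuples of product `p`, the series `∑ |G(d)| (∏ dᵢ)^(-s)` converges for `s > 1/2`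
(`summable_absCoeff`, `summable_tupleMoebius`). Comparing volumes, `N_d(x)` is `V_k x^(k/2) / (2^k ∏
dᵢ)` up to `O(x^((k-θ)/2) (∏ dᵢ)^(θ-1))`, for every `0 ≤ θ ≤ 1` and uniformly in `d`
(`abs_divCount_sub_le`). Taking `θ = 1/2 - 2ε` makes the errors summable.

The main terms sum to `∑_d G(d) / ∏ dᵢ`, whose Euler product is `E_{f,k}` because `(1 - 1/p)^k`
performs the Möbius transform on the local series (`hasSum_tupleMoebius_prime_pow`,
`hasProd_localFactor`). -/

/-! ### Möbius inversion and multiplicativity in several variables. -/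

/-- A function on `k`-tuples which is multiplicative on pairs of tuples whose entries divide two
coprime integers. -/
def TupleMultiplicative {R : Type*} [Mul R] {k : ℕ} (w : (Fin k → ℕ) → R) : Prop :=
  ∀ m n : ℕ, m.Coprime n → m ≠ 0 → n ≠ 0 → ∀ a b : Fin k → ℕ,
    (∀ i, a i ∣ m) → (∀ i, b i ∣ n) → w (a * b) = w a * w b

/-- The convolution of `F` with the Möbius function in each variable. -/
noncomputable def tupleMoebius {k : ℕ} (F : (Fin k → ℕ) → ℂ) (d : Fin k → ℕ) : ℂ :=
  ∑ b ∈ Fintype.piFinset fun i => (d i).divisors, (∏ i, (moebius (d i / b i) : ℂ)) * F b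

theorem sum_moebius_div_eq {b n : ℕ} (hn : n ≠ 0) (hb : b ∣ n) :
    ∑ d ∈ n.divisors with b ∣ d, (moebius (d / b) : ℂ) = if n = b then 1 else 0 := by
  obtain ⟨c, rfl⟩ := hb
  have hb0 : b ≠ 0 := left_ne_zero_of_mul hn
  have hc0 : c ≠ 0 := right_ne_zero_of_mul hn
  have h1 : ∑ d ∈ (b * c).divisors with b ∣ d, (moebius (d / b) : ℂ)
      = ∑ e ∈ c.divisors, (moebius e : ℂ) := by
    refine (sum_nbij' (fun e => b * e) (fun d => d / b) ?_ ?_ ?_ ?_ ?_).symm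
    · intro e he
      simp only [mem_filter, Nat.mem_divisors] at he ⊢
      exact ⟨⟨mul_dvd_mul_left b he.1, hn⟩, dvd_mul_right _ _⟩
    · intro d hd
      simp only [mem_filter, Nat.mem_divisors] at hd ⊢
      obtain ⟨⟨h, -⟩, e, rfl⟩ := hd
      rw [Nat.mul_div_cancel_left _ (Nat.pos_of_ne_zero hb0)]
      exact ⟨Nat.dvd_of_mul_dvd_mul_left (Nat.pos_of_ne_zero hb0) h, hc0⟩
    · intro e _
      exact Nat.mul_div_cancel_left _ (Nat.pos_of_ne_zero hb0)
    · intro d hd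
      exact Nat.mul_div_cancel' (mem_filter.1 hd).2
    · intro e _
      rw [Nat.mul_div_cancel_left _ (Nat.pos_of_ne_zero hb0)]
  have h2 : ∑ e ∈ c.divisors, moebius e = if c = 1 then 1 else 0 := by
    rw [← coe_mul_zeta_apply, moebius_mul_coe_zeta, one_apply]
  rw [h1, ← Int.cast_sum, h2]
  have : b * c = b ↔ c = 1 := by
    rw [Nat.mul_eq_left hb0]
  simp [this]

/-- Möbius inversion in several variables. -/
theorem sum_tupleMoebius {k : ℕ} (F : (Fin k → ℕ) → ℂ) {n : Fin k → ℕ} (hn : ∀ i, n i ≠ 0) :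
    ∑ d ∈ Fintype.piFinset fun i => (n i).divisors, tupleMoebius F d = F n := by
  unfold tupleMoebius
  -- For fixed `b`, the sum over `d` factors over the coordinates, and each factor detects `n i = b
  -- i`.
  rw [sum_comm' (s' := fun b => Fintype.piFinset fun i => {d ∈ (n i).divisors | b i ∣ d})
    (t' := Fintype.piFinset fun i => (n i).divisors)]
  · have h : ∀ b ∈ Fintype.piFinset fun i => (n i).divisors,
        ∑ d ∈ Fintype.piFinset fun i => {d ∈ (n i).divisors | b i ∣ d},
          (∏ i, (moebius (d i / b i) : ℂ)) * F b = if n = b then F b else 0 := by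
      intro b hb
      rw [← sum_mul, ← prod_univ_sum (fun i => {d ∈ (n i).divisors | b i ∣ d})
        (fun i d => (moebius (d / b i) : ℂ))]
      simp only [Fintype.mem_piFinset] at hb
      rw [prod_congr rfl fun i _ => sum_moebius_div_eq (hn i) (Nat.dvd_of_mem_divisors (hb i))]
      rw [prod_ite_zero]
      simp [funext_iff]
    rw [sum_congr rfl h]
    simp [hn]
  · intro d b
    simp only [Fintype.mem_piFinset, mem_filter, Nat.mem_divisors]
    constructor
    · rintro ⟨h1, h2⟩
      exact ⟨fun i => ⟨h1 i, (h2 i).1⟩, fun i => ⟨(h2 i).1.trans (h1 i).1, hn i⟩⟩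
    · rintro ⟨h1, h2⟩
      exact ⟨fun i => (h1 i).1, fun i => ⟨(h1 i).2, ne_zero_of_dvd_ne_zero (hn i) (h1 i).1.1⟩⟩

theorem gcd_mul_eq_left {a b m n : ℕ} (hmn : m.Coprime n) (ha : a ∣ m) (hb : b ∣ n) :
    Nat.gcd (a * b) m = a := by
  rw [Nat.Coprime.gcd_mul_right_cancel a (Nat.Coprime.coprime_dvd_left hb hmn.symm)]
  exact Nat.gcd_eq_left ha

theorem gcd_mul_eq_right {a b m n : ℕ} (hmn : m.Coprime n) (ha : a ∣ m) (hb : b ∣ n) :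
    Nat.gcd (a * b) n = b := by
  rw [mul_comm]
  exact gcd_mul_eq_left hmn.symm hb ha

/-- Coprimality lets `u` and `v` be recovered from `u * v` by coordinatewise gcds with `a` and `b`.
-/
theorem sum_piFinset_divisors_mul {M : Type*} [AddCommMonoid M] {k m n : ℕ} (hmn : m.Coprime n)
    (hm : m ≠ 0) (hn : n ≠ 0) {a b : Fin k → ℕ} (ha : ∀ i, a i ∣ m) (hb : ∀ i, b i ∣ n)
    (g : (Fin k → ℕ) → M) :
    ∑ c ∈ Fintype.piFinset fun i => ((a * b) i).divisors, g c =
      ∑ u ∈ Fintype.piFinset fun i => (a i).divisors,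
        ∑ v ∈ Fintype.piFinset fun i => (b i).divisors, g (u * v) := by
  have hab : ∀ i, (a i).Coprime (b i) := fun i =>
    (hmn.coprime_dvd_left (ha i)).coprime_dvd_right (hb i)
  have ha0 : ∀ i, a i ≠ 0 := fun i => ne_zero_of_dvd_ne_zero hm (ha i)
  have hb0 : ∀ i, b i ≠ 0 := fun i => ne_zero_of_dvd_ne_zero hn (hb i)
  rw [← sum_product']
  refine (sum_nbij' (fun u => u.1 * u.2)
    (fun c => (fun i => Nat.gcd (c i) (a i), fun i => Nat.gcd (c i) (b i))) ?_ ?_ ?_ ?_ ?_).symm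
  · intro u hu
    simp only [mem_product, Fintype.mem_piFinset, Nat.mem_divisors, Pi.mul_apply] at hu ⊢
    exact fun i => ⟨mul_dvd_mul (hu.1 i).1 (hu.2 i).1, mul_ne_zero (ha0 i) (hb0 i)⟩
  · intro c hc
    simp only [mem_product, Fintype.mem_piFinset, Nat.mem_divisors]
    exact ⟨fun i => ⟨Nat.gcd_dvd_right _ _, ha0 i⟩, fun i => ⟨Nat.gcd_dvd_right _ _, hb0 i⟩⟩
  · intro u hu
    simp only [mem_product, Fintype.mem_piFinset, Nat.mem_divisors] at hu
    refine Prod.ext (funext fun i => ?_) (funext fun i => ?_)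
    · exact gcd_mul_eq_left (hab i) (hu.1 i).1 (hu.2 i).1
    · exact gcd_mul_eq_right (hab i) (hu.1 i).1 (hu.2 i).1
  · intro c hc
    simp only [Fintype.mem_piFinset, Nat.mem_divisors, Pi.mul_apply] at hc
    refine funext fun i => ?_
    simp only [Pi.mul_apply]
    rw [← (hab i).gcd_mul, Nat.gcd_eq_left (hc i).1]
  · intro u _
    rfl

theorem sum_finMulAntidiag_mul {M : Type*} [AddCommMonoid M] {k m n : ℕ} (hmn : m.Coprime n)
    (hm : m ≠ 0) (hn : n ≠ 0) (g : (Fin k → ℕ) → M) :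
    ∑ c ∈ Nat.finMulAntidiag k (m * n), g c =
      ∑ u ∈ Nat.finMulAntidiag k m, ∑ v ∈ Nat.finMulAntidiag k n, g (u * v) := by
  rw [← sum_product']
  -- The gcd products with `m` and with `n` multiply to `m * n`, and each is coprime to the other
  -- modulus; hence the first is `m`.
  have key : ∀ {m n : ℕ}, m.Coprime n → m ≠ 0 → ∀ c : Fin k → ℕ, (∏ i, c i = m * n) →
      ∏ i, Nat.gcd (c i) m = m := by
    intro m n hmn hm c hc
    have h1 : (∏ i, Nat.gcd (c i) m) * ∏ i, Nat.gcd (c i) n = m * n := by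
      rw [← prod_mul_distrib, ← hc]
      refine prod_congr rfl fun i _ => ?_
      rw [← hmn.gcd_mul, Nat.gcd_eq_left]
      rw [← hc]
      exact dvd_prod_of_mem c (mem_univ i)
    have h2 : (∏ i, Nat.gcd (c i) m).Coprime n :=
      Nat.Coprime.prod_left fun i _ => hmn.coprime_dvd_left (Nat.gcd_dvd_right _ _)
    have h3 : m.Coprime (∏ i, Nat.gcd (c i) n) :=
      Nat.Coprime.prod_right fun i _ => hmn.coprime_dvd_right (Nat.gcd_dvd_right _ _)
    refine Nat.dvd_antisymm ?_ ?_
    · exact h2.dvd_of_dvd_mul_right (h1 ▸ dvd_mul_right _ _)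
    · exact h3.dvd_of_dvd_mul_right (h1 ▸ dvd_mul_right _ _)
  refine (sum_nbij' (fun u => u.1 * u.2)
    (fun c => (fun i => Nat.gcd (c i) m, fun i => Nat.gcd (c i) n)) ?_ ?_ ?_ ?_ ?_).symm
  · intro u hu
    simp only [mem_product, Nat.mem_finMulAntidiag, Pi.mul_apply, prod_mul_distrib] at hu ⊢
    rw [hu.1.1, hu.2.1]
    exact ⟨rfl, mul_ne_zero hm hn⟩
  · intro c hc
    simp only [mem_product, Nat.mem_finMulAntidiag] at hc ⊢
    exact ⟨⟨key hmn hm c hc.1, hm⟩, ⟨key hmn.symm hn c (by rw [hc.1, mul_comm]), hn⟩⟩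
  · intro u hu
    simp only [mem_product] at hu
    have h1 := Nat.dvd_of_mem_finMulAntidiag hu.1
    have h2 := Nat.dvd_of_mem_finMulAntidiag hu.2
    refine Prod.ext (funext fun i => ?_) (funext fun i => ?_)
    · exact gcd_mul_eq_left hmn (h1 i) (h2 i)
    · exact gcd_mul_eq_right hmn (h1 i) (h2 i)
  · intro c hc
    refine funext fun i => ?_
    simp only [Pi.mul_apply]
    rw [← hmn.gcd_mul, Nat.gcd_eq_left (Nat.dvd_of_mem_finMulAntidiag hc i)]
  · intro u _
    rfl

theorem TupleMultiplicative.tupleMoebius {k : ℕ} {F : (Fin k → ℕ) → ℂ}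
    (hF : TupleMultiplicative F) : TupleMultiplicative (tupleMoebius F) := by
  intro m n hmn hm hn a b ha hb
  unfold SphericalLCM.tupleMoebius
  rw [sum_piFinset_divisors_mul hmn hm hn ha hb, sum_mul_sum]
  refine sum_congr rfl fun u hu => sum_congr rfl fun v hv => ?_
  simp only [Fintype.mem_piFinset, Nat.mem_divisors] at hu hv
  rw [hF m n hmn hm hn u v (fun i => (hu i).1.trans (ha i)) (fun i => (hv i).1.trans (hb i))]
  have : ∏ i, (moebius ((a * b) i / (u * v) i) : ℂ) =
      (∏ i, (moebius (a i / u i) : ℂ)) * ∏ i, (moebius (b i / v i) : ℂ) := by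
    rw [← prod_mul_distrib]
    refine prod_congr rfl fun i _ => ?_
    rw [Pi.mul_apply, Pi.mul_apply, Nat.mul_div_mul_comm (hu i).1 (hv i).1,
      isMultiplicative_moebius.map_mul_of_coprime, Int.cast_mul]
    exact (hmn.coprime_dvd_left ((Nat.div_dvd_of_dvd (hu i).1).trans (ha i))).coprime_dvd_right
      ((Nat.div_dvd_of_dvd (hv i).1).trans (hb i))
  rw [this]
  ring

theorem TupleMultiplicative.sum_finMulAntidiag {R : Type*} [CommSemiring R] {k : ℕ}
    {w : (Fin k → ℕ) → R} (hw : TupleMultiplicative w) {m n : ℕ} (hmn : m.Coprime n) :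
    ∑ c ∈ Nat.finMulAntidiag k (m * n), w c =
      (∑ c ∈ Nat.finMulAntidiag k m, w c) * ∑ c ∈ Nat.finMulAntidiag k n, w c := by
  rcases eq_or_ne m 0 with rfl | hm
  · simp
  rcases eq_or_ne n 0 with rfl | hn
  · simp
  rw [sum_finMulAntidiag_mul hmn hm hn, sum_mul_sum]
  refine sum_congr rfl fun u hu => sum_congr rfl fun v hv => ?_
  exact hw m n hmn hm hn u v (Nat.dvd_of_mem_finMulAntidiag hu) (Nat.dvd_of_mem_finMulAntidiag hv)

theorem lcm_mul_of_coprime {k m n : ℕ} (hmn : m.Coprime n) {a b : Fin k → ℕ}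
    (ha : ∀ i, a i ∣ m) (hb : ∀ i, b i ∣ n) :
    univ.lcm (a * b) = univ.lcm a * univ.lcm b := by
  refine Nat.dvd_antisymm ?_ ?_
  · exact Finset.lcm_dvd fun i hi => mul_dvd_mul (dvd_lcm hi) (dvd_lcm hi)
  · refine Nat.Coprime.mul_dvd_of_dvd_of_dvd ?_ ?_ ?_
    · exact (hmn.coprime_dvd_left (Finset.lcm_dvd fun i _ => ha i)).coprime_dvd_right
        (Finset.lcm_dvd fun i _ => hb i)
    · exact Finset.lcm_dvd fun i hi => (dvd_mul_right _ _).trans (dvd_lcm (f := a * b) hi)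
    · exact Finset.lcm_dvd fun i hi => (dvd_mul_left _ _).trans (dvd_lcm (f := a * b) hi)

theorem tupleMultiplicative_lcm {k : ℕ} {f : ArithmeticFunction ℂ} (hf : f.IsMultiplicative) :
    TupleMultiplicative fun n : Fin k → ℕ => f (univ.lcm n) := by
  intro m n hmn _ _ a b ha hb
  dsimp only
  rw [lcm_mul_of_coprime hmn ha hb, hf.map_mul_of_coprime]
  exact (hmn.coprime_dvd_left (Finset.lcm_dvd fun i _ => ha i)).coprime_dvd_right
        (Finset.lcm_dvd fun i _ => hb i)


/-! ### Absolute convergence of the Dirichlet series of the Möbius transform. -/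

/-- Partial sums are dominated by the Euler product over smooth numbers, and `∏ (1 + b p) ≤ exp (∑
b)`. -/
theorem summable_of_multiplicative {u b : ℕ → ℝ} (hu : ∀ n, 0 ≤ u n) (h0 : u 0 = 0) (h1 : u 1 = 1)
    (hmul : ∀ {m n : ℕ}, m.Coprime n → u (m * n) = u m * u n) (hb : ∀ n, 0 ≤ b n)
    (hbs : Summable b) (hs : ∀ p : ℕ, p.Prime → Summable fun e => u (p ^ (e + 1)))
    (hle : ∀ p : ℕ, p.Prime → ∑' e, u (p ^ (e + 1)) ≤ b p) : Summable u := by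
  have hs' : ∀ {p : ℕ}, p.Prime → Summable fun e => u (p ^ e) := fun {p} hp =>
    (summable_nat_add_iff 1).1 (hs p hp)
  refine summable_of_sum_range_le (c := Real.exp (∑' n, b n)) hu fun N => ?_
  obtain ⟨hS, hH⟩ := EulerProduct.summable_and_hasSum_smoothNumbers_prod_primesBelow_tsum h1 hmul
    (fun {p} hp => by simpa only [Real.norm_of_nonneg (hu _)] using hs' hp) N
  simp only [Real.norm_of_nonneg (hu _)] at hS
  have hS' : Summable (N.smoothNumbers.indicator u) := summable_subtype_iff_indicator.1 hS
  calc ∑ n ∈ range N, u n = ∑ n ∈ range N, N.smoothNumbers.indicator u n := by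
        refine sum_congr rfl fun n hn => ?_
        rcases Nat.eq_zero_or_pos n with rfl | hn0
        · rw [h0, Set.indicator_apply]
          split_ifs <;> simp [h0]
        · rw [Set.indicator_of_mem]
          exact Nat.mem_smoothNumbers_of_lt hn0 (mem_range.1 hn)
    _ ≤ ∑' n, N.smoothNumbers.indicator u n :=
        hS'.sum_le_tsum _ fun n _ => Set.indicator_nonneg (fun n _ => hu n) n
    _ = ∏ p ∈ N.primesBelow, ∑' e, u (p ^ e) := by
        rw [← _root_.tsum_subtype, hH.tsum_eq]
    _ ≤ ∏ p ∈ N.primesBelow, Real.exp (b p) := by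
        refine prod_le_prod (fun p _ => tsum_nonneg fun e => hu _) fun p hp => ?_
        have hp' := Nat.prime_of_mem_primesBelow hp
        rw [(hs' hp').tsum_eq_zero_add, pow_zero, h1, add_comm]
        exact (add_le_add_left (hle p hp') 1).trans (Real.add_one_le_exp _)
    _ ≤ Real.exp (∑' n, b n) := by
        rw [← Real.exp_sum]
        exact Real.exp_le_exp.2 (hbs.sum_le_tsum _ fun n _ => hb n)

/-- The `k`-variable function `n ↦ f([n₁, …, n_k])`. -/
def lcmFun (f : ArithmeticFunction ℂ) (k : ℕ) (n : Fin k → ℕ) : ℂ :=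
  f (univ.lcm n)

theorem ClassA.exists_bound {f : ArithmeticFunction ℂ} (hf : ClassA 0 f) :
    ∃ C : ℝ, 0 ≤ C ∧ (∀ p : ℕ, p.Prime → ‖f p - 1‖ ≤ C * (p : ℝ) ^ (-(1 / 2) : ℝ)) ∧
      ∀ p ν : ℕ, p.Prime → ‖f (p ^ ν)‖ ≤ C := by
  obtain ⟨C₁, h₁⟩ := hf.bound_prime
  obtain ⟨C₂, h₂⟩ := hf.bound_prime_pow
  simp only [Real.rpow_zero, Complex.ofReal_one, zero_sub, mul_zero, mul_one] at h₁ h₂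
  refine ⟨|C₁| + |C₂| + 1, by positivity, fun p hp => (h₁ p hp).trans ?_, fun p ν hp => ?_⟩
  · gcongr
    linarith [le_abs_self C₁, abs_nonneg C₂]
  · rcases Nat.lt_or_ge ν 2 with hν | hν
    · interval_cases ν
      · rw [pow_zero, hf.isMultiplicative.map_one, norm_one]
        linarith [abs_nonneg C₁, abs_nonneg C₂]
      · have h3 : (p : ℝ) ^ (-(1 / 2) : ℝ) ≤ 1 :=
          Real.rpow_le_one_of_one_le_of_nonpos (by exact_mod_cast hp.one_le) (by norm_num)
        have h4 : C₁ * (p : ℝ) ^ (-(1 / 2) : ℝ) ≤ |C₁| :=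
          (mul_le_mul_of_nonneg_right (le_abs_self C₁) (by positivity)).trans
            (mul_le_of_le_one_right (abs_nonneg _) h3)
        have h5 : ‖f p‖ ≤ ‖f p - 1‖ + 1 := by
          simpa using norm_add_le (f p - 1) 1
        rw [pow_one]
        linarith [h₁ p hp, abs_nonneg C₂]
    · linarith [h₂ p ν hp hν, le_abs_self C₂, abs_nonneg C₁]

/-- Since `Nat.divisors 0 = ∅`, tuples with a zero entry drop out, so later series may run over all
of `Fin k → ℕ`. -/
theorem tupleMoebius_eq_zero {k : ℕ} (F : (Fin k → ℕ) → ℂ) {d : Fin k → ℕ} {i : Fin k}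
    (hi : d i = 0) : tupleMoebius F d = 0 := by
  unfold tupleMoebius
  have h : (Fintype.piFinset fun i => (d i).divisors) = ∅ :=
    eq_empty_of_forall_notMem fun b hb => by simpa [hi] using Fintype.mem_piFinset.1 hb i
  rw [h, sum_empty]

theorem tupleMoebius_one {k : ℕ} (F : (Fin k → ℕ) → ℂ) : tupleMoebius F (fun _ => 1) = F fun _ => 1 := by
  have := sum_tupleMoebius F (n := fun _ => 1) (by simp)
  simpa using this

theorem lcmFun_one {f : ArithmeticFunction ℂ} (hf : f.IsMultiplicative) (k : ℕ) :
    lcmFun f k (fun _ => 1) = 1 := by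
  have : univ.lcm (fun _ : Fin k => 1) = 1 :=
    Nat.dvd_one.1 (Finset.lcm_dvd fun i _ => dvd_rfl)
  rw [lcmFun, this, hf.map_one]

theorem lcmFun_mulSingle {k : ℕ} (f : ArithmeticFunction ℂ) (i : Fin k) (p : ℕ) :
    lcmFun f k (Pi.mulSingle i p) = f p := by
  have : univ.lcm (Pi.mulSingle i p : Fin k → ℕ) = p := by
    refine Nat.dvd_antisymm (Finset.lcm_dvd fun j _ => ?_) ?_
    · rcases eq_or_ne j i with rfl | h
      · simp
      · simp [h]
    · simpa using dvd_lcm (f := (Pi.mulSingle i p : Fin k → ℕ)) (mem_univ i)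
  rw [lcmFun, this]

theorem piFinset_divisors_mulSingle {k p : ℕ} (hp : p.Prime) (i : Fin k) :
    (Fintype.piFinset fun j => ((Pi.mulSingle i p : Fin k → ℕ) j).divisors) =
      {1, Pi.mulSingle i p} := by
  ext b
  simp only [Fintype.mem_piFinset, mem_insert, mem_singleton]
  constructor
  · intro h
    have h1 : ∀ j, j ≠ i → b j = 1 := fun j hj => by simpa [hj] using h j
    have h2 := h i
    rw [Pi.mulSingle_eq_same, hp.divisors, mem_insert, mem_singleton] at h2
    refine h2.imp (fun h2 => funext fun j => ?_) fun h2 => funext fun j => ?_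
    · rcases eq_or_ne j i with rfl | hj
      · exact h2
      · exact h1 j hj
    · rcases eq_or_ne j i with rfl | hj
      · simpa using h2
      · simpa [hj] using h1 j hj
  · rintro (rfl | rfl) j
    · rcases eq_or_ne j i with rfl | hj
      · simp [hp.ne_zero]
      · simp [hj]
    · rcases eq_or_ne j i with rfl | hj
      · simp [hp.ne_zero]
      · simp [hj]

/-- Inversion at this tuple has only two terms, one of them `1`. This is where the closeness of `f
p` to `1` enters. -/
theorem tupleMoebius_mulSingle {k p : ℕ} (hp : p.Prime) {f : ArithmeticFunction ℂ}
    (hf : f.IsMultiplicative) (i : Fin k) :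
    tupleMoebius (lcmFun f k) (Pi.mulSingle i p) = f p - 1 := by
  have h := sum_tupleMoebius (lcmFun f k) (n := Pi.mulSingle i p) fun j => by
    rcases eq_or_ne j i with rfl | hj
    · simp [hp.ne_zero]
    · simp [hj]
  have hne : (1 : Fin k → ℕ) ≠ Pi.mulSingle i p := fun h => hp.ne_one (by
    simpa using (congrFun h i).symm)
  rw [piFinset_divisors_mulSingle hp, sum_pair hne, lcmFun_mulSingle] at h
  have h1 : tupleMoebius (lcmFun f k) 1 = 1 :=
    (tupleMoebius_one _).trans (lcmFun_one hf k)
  rw [h1] at h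
  exact eq_sub_of_add_eq' h

theorem exists_eq_mulSingle {k p : ℕ} (hp : p.Prime) {d : Fin k → ℕ} (hd : ∏ i, d i = p) :
    ∃ i, d = Pi.mulSingle i p := by
  obtain ⟨i, -, hi⟩ := hp.prime.exists_mem_finset_dvd (s := univ) (f := d) (by rw [hd])
  have hi' : d i = p := Nat.dvd_antisymm (hd ▸ dvd_prod_of_mem d (mem_univ i)) hi
  refine ⟨i, funext fun j => ?_⟩
  rcases eq_or_ne j i with rfl | hj
  · simpa using hi'
  · rw [← mul_prod_erase univ d (mem_univ i), hi'] at hd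
    have h1 := Nat.eq_of_mul_eq_mul_left hp.pos (hd.trans (mul_one p).symm)
    simpa [hj] using (prod_eq_one_iff.1 h1) j (by simp [hj])

/-- The sum of `|G(d)|` over the `k`-tuples `d` with product `n`, where `G` is the Möbius transform
of `lcmFun f k`. -/
noncomputable def absCoeff (f : ArithmeticFunction ℂ) (k n : ℕ) : ℝ :=
  ∑ d ∈ Nat.finMulAntidiag k n, ‖tupleMoebius (lcmFun f k) d‖

theorem absCoeff_nonneg (f : ArithmeticFunction ℂ) (k n : ℕ) : 0 ≤ absCoeff f k n :=
  sum_nonneg fun _ _ => norm_nonneg _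

theorem absCoeff_prime_le {k p : ℕ} (hp : p.Prime) {f : ArithmeticFunction ℂ}
    (hf : f.IsMultiplicative) : absCoeff f k p ≤ k * ‖f p - 1‖ := by
  have hsub : Nat.finMulAntidiag k p ⊆ univ.image fun i : Fin k => (Pi.mulSingle i p : Fin k → ℕ) := by
    intro d hd
    obtain ⟨i, rfl⟩ := exists_eq_mulSingle hp (Nat.prod_eq_of_mem_finMulAntidiag hd)
    exact mem_image_of_mem _ (mem_univ i)
  calc absCoeff f k p ≤ ∑ d ∈ Nat.finMulAntidiag k p, ‖f p - 1‖ := by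
        refine sum_le_sum fun d hd => ?_
        obtain ⟨i, rfl⟩ := exists_eq_mulSingle hp (Nat.prod_eq_of_mem_finMulAntidiag hd)
        rw [tupleMoebius_mulSingle hp hf]
    _ = #(Nat.finMulAntidiag k p) * ‖f p - 1‖ := by rw [sum_const, nsmul_eq_mul]
    _ ≤ k * ‖f p - 1‖ := by
        gcongr
        exact ((card_le_card hsub).trans card_image_le).trans (by simp)

/-- Count the divisor tuples: each term is at most `C`, as lcms of powers of `p` are powers of `p`.
Polynomial growth in `n` is harmless against geometric decay. -/
theorem norm_tupleMoebius_le {k p n : ℕ} (hp : p.Prime) {f : ArithmeticFunction ℂ} {C : ℝ}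
    (hC : ∀ ν : ℕ, ‖f (p ^ ν)‖ ≤ C) {d : Fin k → ℕ} (hd : ∀ i, d i ∣ p ^ n) :
    ‖tupleMoebius (lcmFun f k) d‖ ≤ C * (n + 1) ^ k := by
  have hC0 : 0 ≤ C := (norm_nonneg _).trans (hC 0)
  have hcard : #(Fintype.piFinset fun i => (d i).divisors) ≤ (n + 1) ^ k := by
    rw [Fintype.card_piFinset]
    refine (prod_le_pow_card _ _ (n + 1) fun i _ => ?_).trans (by simp)
    calc #(d i).divisors ≤ #(p ^ n).divisors :=
          card_le_card (Nat.divisors_subset_of_dvd (pow_ne_zero n hp.ne_zero) (hd i))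
      _ = n + 1 := by rw [Nat.divisors_prime_pow hp, card_map, card_range]
  calc ‖tupleMoebius (lcmFun f k) d‖
      ≤ ∑ b ∈ Fintype.piFinset fun i => (d i).divisors, C := by
        refine norm_sum_le_of_le _ fun b hb => ?_
        rw [norm_mul, norm_prod]
        have h1 : ∏ i, ‖(moebius (d i / b i) : ℂ)‖ ≤ 1 := by
          refine prod_le_one (fun i _ => norm_nonneg _) fun i _ => ?_
          rw [Complex.norm_intCast]
          exact_mod_cast abs_moebius_le_one
        have h2 : univ.lcm b ∣ p ^ n := Finset.lcm_dvd fun i _ =>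
          (Nat.dvd_of_mem_divisors (Fintype.mem_piFinset.1 hb i)).trans (hd i)
        obtain ⟨j, -, hj⟩ := (Nat.dvd_prime_pow hp).1 h2
        calc _ ≤ 1 * C := by
              gcongr
              rw [lcmFun, hj]
              exact hC j
          _ = C := one_mul C
    _ = #(Fintype.piFinset fun i => (d i).divisors) * C := by rw [sum_const, nsmul_eq_mul]
    _ ≤ ((n + 1 : ℕ) ^ k : ℕ) * C := by gcongr
    _ = C * (n + 1) ^ k := by push_cast; ring

theorem absCoeff_prime_pow_le {k p : ℕ} (hp : p.Prime) {f : ArithmeticFunction ℂ} {C : ℝ}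
    (hC : ∀ ν : ℕ, ‖f (p ^ ν)‖ ≤ C) (n : ℕ) :
    absCoeff f k (p ^ n) ≤ C * (n + 1) ^ (2 * k) := by
  have hC0 : 0 ≤ C := (norm_nonneg _).trans (hC 0)
  have hcard : #(Nat.finMulAntidiag k (p ^ n)) ≤ (n + 1) ^ k := by
    rw [Nat.finMulAntidiag_eq_piFinset_divisors_filter dvd_rfl (pow_ne_zero n hp.ne_zero)]
    refine (card_filter_le _ _).trans ?_
    rw [Fintype.card_piFinset, Nat.divisors_prime_pow hp, card_map, card_range]
    simp
  calc absCoeff f k (p ^ n) ≤ ∑ d ∈ Nat.finMulAntidiag k (p ^ n), C * (n + 1) ^ k :=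
        sum_le_sum fun d hd => norm_tupleMoebius_le hp hC (Nat.dvd_of_mem_finMulAntidiag hd)
    _ = #(Nat.finMulAntidiag k (p ^ n)) * (C * (n + 1) ^ k) := by rw [sum_const, nsmul_eq_mul]
    _ ≤ ((n + 1 : ℕ) ^ k : ℕ) * (C * (n + 1) ^ k) := by gcongr
    _ = C * (n + 1) ^ (2 * k) := by push_cast; ring

theorem tupleMultiplicative_tupleMoebius_lcmFun {f : ArithmeticFunction ℂ}
    (hf : f.IsMultiplicative) (k : ℕ) : TupleMultiplicative (tupleMoebius (lcmFun f k)) :=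
  TupleMultiplicative.tupleMoebius (tupleMultiplicative_lcm hf)

theorem absCoeff_mul {f : ArithmeticFunction ℂ} (hf : f.IsMultiplicative) (k : ℕ) {m n : ℕ}
    (hmn : m.Coprime n) : absCoeff f k (m * n) = absCoeff f k m * absCoeff f k n := by
  refine TupleMultiplicative.sum_finMulAntidiag
    (w := fun d => ‖tupleMoebius (lcmFun f k) d‖) ?_ hmn
  intro m n h hm hn a b ha hb
  dsimp only
  rw [tupleMultiplicative_tupleMoebius_lcmFun hf k m n h hm hn a b ha hb, norm_mul]

/-- The local sum at `p` is `O(p^(-1/2-s))` from the first power and `O(p^(-2s))` from the higher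
ones; both are summable when `s > 1/2`. -/
theorem summable_absCoeff {f : ArithmeticFunction ℂ} (hf : ClassA 0 f) (k : ℕ) {s : ℝ}
    (hs : 1 / 2 < s) : Summable fun n : ℕ => absCoeff f k n * (n : ℝ) ^ (-s) := by
  obtain ⟨C, hC0, hC1, hC2⟩ := hf.exists_bound
  have hmult := hf.isMultiplicative
  -- `q` bounds `p ^ (-s)` for every prime, so the constant `K` below does not depend on `p`.
  set q : ℝ := (2 : ℝ) ^ (-s) with hq
  have hq0 : 0 ≤ q := by positivity
  have hq1 : q < 1 := Real.rpow_lt_one_of_one_lt_of_neg (by norm_num) (by linarith)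
  have hK : Summable fun e : ℕ => ((e : ℝ) + 3) ^ (2 * k) * q ^ e := by
    have h1 : Summable fun e : ℕ => (e : ℝ) ^ (2 * k) * q ^ e :=
      summable_pow_mul_geometric_of_norm_lt_one (2 * k) (by rwa [Real.norm_of_nonneg hq0])
    have h2 := ((summable_nat_add_iff 3).2 h1).mul_left (q ^ 3)⁻¹
    refine h2.congr fun e => ?_
    have : q ≠ 0 := by positivity
    push_cast
    field_simp
    ring
  set K := ∑' e : ℕ, ((e : ℝ) + 3) ^ (2 * k) * q ^ e
  have hK0 : 0 ≤ K := tsum_nonneg fun e => by positivity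
  have hbound : ∀ p : ℕ, p.Prime → ∀ e : ℕ,
      absCoeff f k (p ^ (e + 2)) * ((p ^ (e + 2) : ℕ) : ℝ) ^ (-s) ≤
        (C * (p : ℝ) ^ (-(2 * s))) * (((e : ℝ) + 3) ^ (2 * k) * q ^ e) := by
    intro p hp e
    have hp0 : (0 : ℝ) < p := by exact_mod_cast hp.pos
    have h1 := absCoeff_prime_pow_le (k := k) hp (fun ν => hC2 p ν hp) (e + 2)
    have h2 : ((p ^ (e + 2) : ℕ) : ℝ) ^ (-s) = (p : ℝ) ^ (-(2 * s)) * ((p : ℝ) ^ (-s)) ^ e := by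
      rw [Nat.cast_pow, ← Real.rpow_natCast, ← Real.rpow_mul hp0.le, ← Real.rpow_natCast,
        ← Real.rpow_mul hp0.le, ← Real.rpow_add hp0]
      congr 1
      push_cast
      ring
    have h3 : (p : ℝ) ^ (-s) ≤ q :=
      Real.rpow_le_rpow_of_nonpos (by norm_num) (by exact_mod_cast hp.two_le) (by linarith)
    rw [h2]
    calc _ ≤ (C * (((e + 2 : ℕ) : ℝ) + 1) ^ (2 * k)) * ((p : ℝ) ^ (-(2 * s)) * q ^ e) := by
          gcongr
      _ = _ := by push_cast; ring
  have hsumm2 : ∀ p : ℕ, p.Prime →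
      Summable fun e => absCoeff f k (p ^ (e + 2)) * ((p ^ (e + 2) : ℕ) : ℝ) ^ (-s) :=
    fun p hp => Summable.of_nonneg_of_le
      (fun e => mul_nonneg (absCoeff_nonneg f k _) (by positivity)) (hbound p hp) (hK.mul_left _)
  have hsumm1 : ∀ p : ℕ, p.Prime →
      Summable fun e => absCoeff f k (p ^ (e + 1)) * ((p ^ (e + 1) : ℕ) : ℝ) ^ (-s) :=
    fun p hp => (summable_nat_add_iff 1).1 (hsumm2 p hp)
  refine summable_of_multiplicative
    (b := fun p : ℕ => k * C * (p : ℝ) ^ (-(1 / 2 + s)) + C * K * (p : ℝ) ^ (-(2 * s)))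
    (fun n => mul_nonneg (absCoeff_nonneg f k n) (by positivity)) ?_ ?_ ?_
    (fun n => by positivity) ?_ hsumm1 fun p hp => ?_
  · simp [absCoeff]
  · rw [absCoeff, Nat.finMulAntidiag_one, sum_singleton, tupleMoebius_one, lcmFun_one hmult]
    simp
  · intro m n hmn
    rw [absCoeff_mul hmult k hmn, Nat.cast_mul, Real.mul_rpow (by positivity) (by positivity)]
    ring
  · exact ((Real.summable_nat_rpow.2 (by linarith)).mul_left _).add
      ((Real.summable_nat_rpow.2 (by linarith)).mul_left _)
  · have hp0 : (0 : ℝ) < p := by exact_mod_cast hp.pos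
    rw [(hsumm1 p hp).tsum_eq_zero_add]
    refine add_le_add ?_ ?_
    · rw [zero_add, pow_one, neg_add, Real.rpow_add hp0]
      calc _ ≤ (k * ‖f p - 1‖) * (p : ℝ) ^ (-s) := by
            gcongr
            exact absCoeff_prime_le hp hmult
        _ ≤ (k * (C * (p : ℝ) ^ (-(1 / 2) : ℝ))) * (p : ℝ) ^ (-s) := by
            gcongr
            exact hC1 p hp
        _ = _ := by ring
    · refine ((hsumm2 p hp).tsum_le_tsum (hbound p hp) (hK.mul_left _)).trans_eq ?_
      rw [tsum_mul_left]
      ring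

/-- Group the tuples by their product. -/
theorem summable_tupleMoebius {f : ArithmeticFunction ℂ} (hf : ClassA 0 f) {k : ℕ} {s : ℝ}
    (hs : 1 / 2 < s) :
    Summable fun d : Fin k → ℕ =>
      ‖tupleMoebius (lcmFun f k) d‖ * ((∏ i, d i : ℕ) : ℝ) ^ (-s) := by
  have hS := summable_absCoeff hf k hs
  refine summable_of_sum_le (c := ∑' n : ℕ, absCoeff f k n * (n : ℝ) ^ (-s))
    (fun d => by positivity) fun u => ?_
  rw [← sum_fiberwise_of_maps_to (t := u.image fun d => ∏ i, d i)
    fun d hd => mem_image_of_mem _ hd]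
  refine le_trans (sum_le_sum fun n _ => ?_)
    (hS.sum_le_tsum _ fun n _ => mul_nonneg (absCoeff_nonneg f k n) (by positivity))
  rw [absCoeff, sum_mul]
  have : ∑ d ∈ u with ∏ i, d i = n,
      ‖tupleMoebius (lcmFun f k) d‖ * ((∏ i, d i : ℕ) : ℝ) ^ (-s) =
      ∑ d ∈ u with ∏ i, d i = n, ‖tupleMoebius (lcmFun f k) d‖ * (n : ℝ) ^ (-s) :=
    sum_congr rfl fun d hd => by rw [(mem_filter.1 hd).2]
  rw [this]
  rcases eq_or_ne n 0 with rfl | hn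
  · simp only [Nat.finMulAntidiag_zero_right, sum_empty]
    refine (sum_eq_zero fun d hd => ?_).le
    obtain ⟨i, -, hi⟩ := prod_eq_zero_iff.1 (mem_filter.1 hd).2
    rw [tupleMoebius_eq_zero _ hi, norm_zero, zero_mul]
  · refine sum_le_sum_of_subset_of_nonneg (fun d hd => ?_) fun d _ _ => by positivity
    exact Nat.mem_finMulAntidiag.2 ⟨(mem_filter.1 hd).2, hn⟩


/-! ### Local series and the Euler product. -/

/-- Any finite set of exponents lies in a box, where the sum factors into geometric sums. -/
theorem summable_pow_sum (k : ℕ) {x : ℝ} (hx0 : 0 ≤ x) (hx1 : x < 1) :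
    Summable fun ν : Fin k → ℕ => x ^ ∑ i, ν i := by
  refine summable_of_sum_le (c := ∏ _i : Fin k, (1 - x)⁻¹) (fun ν => by positivity) fun u => ?_
  set N := u.sup fun ν => univ.sup ν with hN
  have hsub : u ⊆ Fintype.piFinset fun _ : Fin k => range (N + 1) := by
    intro ν hν
    refine Fintype.mem_piFinset.2 fun i => mem_range.2 (Nat.lt_succ_of_le ?_)
    exact (le_sup (f := ν) (mem_univ i)).trans (le_sup (f := fun ν : Fin k → ℕ => univ.sup ν) hν)
  calc ∑ ν ∈ u, x ^ ∑ i, ν i ≤ ∑ ν ∈ Fintype.piFinset fun _ : Fin k => range (N + 1), x ^ ∑ i, ν i :=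
        sum_le_sum_of_subset_of_nonneg hsub fun ν _ _ => by positivity
    _ = ∏ _i : Fin k, ∑ a ∈ range (N + 1), x ^ a := by
        rw [prod_univ_sum]
        exact sum_congr rfl fun ν _ => (prod_pow_eq_pow_sum _ _ _).symm
    _ ≤ ∏ _i : Fin k, (1 - x)⁻¹ := by
        refine prod_le_prod (fun i _ => by positivity) fun i _ => ?_
        rw [← tsum_geometric_of_lt_one hx0 hx1]
        exact (summable_geometric_of_lt_one hx0 hx1).sum_le_tsum _ fun a _ => by positivity

theorem localTerm_eq (f : ArithmeticFunction ℂ) (k p : ℕ) (ν : Fin k → ℕ) :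
    localTerm f k p ν = f (p ^ univ.sup ν) * (1 / (p : ℂ)) ^ ∑ i, ν i := by
  rw [localTerm, div_pow, one_pow, mul_one_div]

theorem summable_localTerm {f : ArithmeticFunction ℂ} (hf : ClassA 0 f) (k : ℕ) {p : ℕ}
    (hp : p.Prime) : Summable (localTerm f k p) := by
  obtain ⟨C, hC0, -, hC⟩ := hf.exists_bound
  have hx1 : 1 / (p : ℝ) < 1 := by
    rw [div_lt_one (by exact_mod_cast hp.pos)]
    exact_mod_cast hp.one_lt
  refine Summable.of_norm_bounded ((summable_pow_sum k (by positivity) hx1).mul_left C) fun ν => ?_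
  rw [localTerm_eq, norm_mul, norm_pow, norm_div, norm_one, Complex.norm_natCast]
  gcongr
  exact hC p _ hp

theorem lcm_prime_pow {k : ℕ} (p : ℕ) (ν : Fin k → ℕ) :
    univ.lcm (fun i => p ^ ν i) = p ^ univ.sup ν := by
  refine Nat.dvd_antisymm (Finset.lcm_dvd fun i hi => pow_dvd_pow p (le_sup hi)) ?_
  rcases isEmpty_or_nonempty (Fin k) with h | h
  · simp
  · obtain ⟨i, hi, hν⟩ := exists_mem_eq_sup univ univ_nonempty ν
    rw [hν]
    exact dvd_lcm (f := fun i => p ^ ν i) hi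

theorem moebius_prime_pow_eq_zero {p a : ℕ} (hp : p.Prime) (ha : 2 ≤ a) : moebius (p ^ a) = 0 := by
  rw [moebius_apply_prime_pow hp (by lia), if_neg (by lia)]

/-- Only exponents `0` and `1` survive the Möbius function. The index set is kept independent of
`ν`, with a condition inside, so that the sum over `ν` can be taken for each `α` separately. -/
theorem tupleMoebius_prime_pow {k p : ℕ} (hp : p.Prime) (f : ArithmeticFunction ℂ)
    (ν : Fin k → ℕ) :
    tupleMoebius (lcmFun f k) (fun i => p ^ ν i) =
      ∑ α ∈ Fintype.piFinset fun _ : Fin k => range 2,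
        if ∀ i, α i ≤ ν i then (∏ i, (moebius (p ^ α i) : ℂ)) * f (p ^ univ.sup (ν - α)) else 0 := by
  have h1 : tupleMoebius (lcmFun f k) (fun i => p ^ ν i) =
      ∑ α ∈ Fintype.piFinset fun i => range (ν i + 1),
        (∏ i, (moebius (p ^ α i) : ℂ)) * f (p ^ univ.sup (ν - α)) := by
    refine (sum_nbij (fun α i => p ^ (ν i - α i)) ?_ ?_ ?_ ?_).symm
    · intro α _
      simp only [Fintype.mem_piFinset]
      exact fun i => Nat.mem_divisors.2 ⟨pow_dvd_pow p (Nat.sub_le _ _), pow_ne_zero _ hp.ne_zero⟩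
    · intro α hα β hβ h
      simp only [Fintype.coe_piFinset, Set.mem_pi, Set.mem_univ, forall_const, mem_coe,
        mem_range] at hα hβ
      funext i
      have := Nat.pow_right_injective hp.two_le (congrFun h i)
      have h2 := hα i
      have h3 := hβ i
      lia
    · intro b hb
      simp only [Fintype.coe_piFinset, Set.mem_pi, Set.mem_univ, forall_const, mem_coe,
        Nat.mem_divisors] at hb
      choose β hβ using fun i => (Nat.dvd_prime_pow hp).1 (hb i).1
      refine ⟨fun i => ν i - β i, ?_, funext fun i => ?_⟩
      · simp only [Fintype.coe_piFinset, Set.mem_pi, Set.mem_univ, forall_const, mem_coe, mem_range]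
        exact fun i => by lia
      · dsimp only
        rw [Nat.sub_sub_self (hβ i).1, (hβ i).2]
    · intro α hα
      simp only [Fintype.mem_piFinset, mem_range] at hα
      rw [lcmFun, lcm_prime_pow p (fun i => ν i - α i)]
      congr 1
      refine prod_congr rfl fun i _ => ?_
      rw [Nat.pow_div (Nat.sub_le _ _) hp.pos, Nat.sub_sub_self (Nat.lt_succ_iff.1 (hα i))]
  rw [h1, ← sum_filter]
  refine (sum_subset (fun α hα => ?_) fun α hα hα' => ?_).symm
  · simp only [mem_filter, Fintype.mem_piFinset, mem_range] at hα ⊢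
    exact fun i => Nat.lt_succ_of_le (hα.2 i)
  · simp only [mem_filter, Fintype.mem_piFinset, mem_range, not_and'] at hα hα'
    have h2 := hα' fun i => Nat.lt_succ_iff.1 (hα i)
    push Not at h2
    obtain ⟨i, hi⟩ := h2
    rw [prod_eq_zero (mem_univ i), zero_mul]
    rw [moebius_prime_pow_eq_zero hp hi, Int.cast_zero]

/-- Expand `(1 - 1/p)^k` over `α ∈ {0,1}^k`; the shift `ν = α + β` turns each term into a multiple
of the local series. -/
theorem hasSum_tupleMoebius_prime_pow {f : ArithmeticFunction ℂ} (hf : ClassA 0 f) (k : ℕ) {p : ℕ}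
    (hp : p.Prime) :
    HasSum (fun ν : Fin k → ℕ =>
      tupleMoebius (lcmFun f k) (fun i => p ^ ν i) * (1 / (p : ℂ)) ^ ∑ i, ν i)
      (localFactor f k p) := by
  set x : ℂ := 1 / (p : ℂ) with hx
  have hT := (summable_localTerm hf k hp).hasSum
  set T := ∑' ν : Fin k → ℕ, localTerm f k p ν with hTdef
  have h1 : localFactor f k p =
      ∑ α ∈ Fintype.piFinset fun _ : Fin k => range 2,
        (∏ i, (moebius (p ^ α i) : ℂ) * x ^ α i) * T := by
    rw [localFactor, ← hx, ← hTdef, ← sum_mul,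
      ← prod_univ_sum (fun _ => range 2) fun _ a => (moebius (p ^ a) : ℂ) * x ^ a]
    congr 1
    simp [sum_range_succ, moebius_apply_prime hp, sub_eq_add_neg]
  have h2 : ∀ ν : Fin k → ℕ,
      tupleMoebius (lcmFun f k) (fun i => p ^ ν i) * x ^ ∑ i, ν i =
      ∑ α ∈ Fintype.piFinset fun _ : Fin k => range 2,
        if ∀ i, α i ≤ ν i then (∏ i, (moebius (p ^ α i) : ℂ)) * f (p ^ univ.sup (ν - α)) * x ^ ∑ i, ν i
        else 0 := by
    intro ν
    rw [tupleMoebius_prime_pow hp, sum_mul]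
    refine sum_congr rfl fun α _ => ?_
    rw [ite_mul, zero_mul]
  simp only [h2]
  rw [h1]
  refine hasSum_sum fun α _ => ?_
  rw [← (add_right_injective α).hasSum_iff]
  · refine (hT.mul_left _).congr_fun ?_
    intro β
    simp only [Function.comp_apply, Pi.add_apply, le_add_iff_nonneg_right, zero_le, implies_true, if_true,
      add_tsub_cancel_left, sum_add_distrib, pow_add]
    rw [localTerm_eq, prod_mul_distrib, prod_pow_eq_pow_sum]
    ring
  · intro ν hν
    rw [if_neg]
    exact fun h => hν ⟨ν - α, funext fun i => by simpa using add_tsub_cancel_of_le (h i)⟩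

/-- `S n` need only contain the support of `c` in its fibre: the tuples of product `0` may form an
infinite fibre. -/
theorem hasSum_sum_of_fiber {A : Type*} {c : A → ℂ} {a : ℂ} (hc : HasSum c a) (g : A → ℕ)
    (S : ℕ → Finset A) (hS : ∀ n, ∀ x ∈ S n, g x = n) (hS' : ∀ x, c x ≠ 0 → x ∈ S (g x)) :
    HasSum (fun n => ∑ x ∈ S n, c x) a := by
  rw [← (Equiv.sigmaFiberEquiv g).hasSum_iff] at hc
  refine hc.sigma fun n => ?_
  have h : HasSum ((g ⁻¹' {n}).indicator c) (∑ x ∈ S n, (g ⁻¹' {n}).indicator c x) := by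
    refine hasSum_sum_of_ne_finset_zero fun x hx => ?_
    by_cases hxn : g x = n
    · rw [Set.indicator_of_mem (by exact hxn)]
      by_contra h0
      exact hx (hxn ▸ hS' x h0)
    · exact Set.indicator_of_notMem (by exact hxn) _
  rw [sum_congr rfl fun x hx => Set.indicator_of_mem (show x ∈ g ⁻¹' {n} from hS n x hx) c] at h
  exact hasSum_subtype_iff_indicator.2 h

/-- The sum of `G(d)` over the `k`-tuples `d` with product `n`, divided by `n`, where `G` is the
Möbius transform of `lcmFun f k`. -/
noncomputable def meanCoeff (f : ArithmeticFunction ℂ) (k n : ℕ) : ℂ :=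
  ∑ d ∈ Nat.finMulAntidiag k n, tupleMoebius (lcmFun f k) d * (1 / ((∏ i, d i : ℕ) : ℂ))

theorem meanCoeff_eq (f : ArithmeticFunction ℂ) (k n : ℕ) :
    meanCoeff f k n =
      (∑ d ∈ Nat.finMulAntidiag k n, tupleMoebius (lcmFun f k) d) * (1 / (n : ℂ)) := by
  rw [meanCoeff, sum_mul]
  exact sum_congr rfl fun d hd => by rw [Nat.prod_eq_of_mem_finMulAntidiag hd]

theorem hasSum_meanCoeff_prime_pow {f : ArithmeticFunction ℂ} (hf : ClassA 0 f) (k : ℕ) {p : ℕ}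
    (hp : p.Prime) : HasSum (fun e : ℕ => meanCoeff f k (p ^ e)) (localFactor f k p) := by
  have h := hasSum_sum_of_fiber (hasSum_tupleMoebius_prime_pow hf k hp) (fun ν => ∑ i, ν i)
    (fun e => piAntidiag univ e) (fun n x hx => (mem_piAntidiag.1 hx).1)
    (fun x _ => mem_piAntidiag.2 ⟨rfl, fun i _ => mem_univ i⟩)
  refine h.congr_fun fun e => ?_
  refine (sum_nbij (fun ν i => p ^ ν i) ?_ ?_ ?_ ?_).symm
  · intro ν hν
    rw [Nat.mem_finMulAntidiag, prod_pow_eq_pow_sum, (mem_piAntidiag.1 hν).1]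
    exact ⟨rfl, pow_ne_zero _ hp.ne_zero⟩
  · intro ν _ μ _ h
    exact funext fun i => Nat.pow_right_injective hp.two_le (congrFun h i)
  · intro d hd
    choose ν hν using fun i => (Nat.dvd_prime_pow hp).1 (Nat.dvd_of_mem_finMulAntidiag hd i)
    refine ⟨ν, ?_, funext fun i => (hν i).2.symm⟩
    refine mem_piAntidiag.2 ⟨?_, fun i _ => mem_univ i⟩
    refine Nat.pow_right_injective hp.two_le ?_
    dsimp only
    rw [← Nat.prod_eq_of_mem_finMulAntidiag hd, ← prod_pow_eq_pow_sum]
    exact prod_congr rfl fun i _ => (hν i).2.symm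
  · intro ν _
    rw [prod_pow_eq_pow_sum, Nat.cast_pow, div_pow, one_pow]

/-- Grouping by product gives an absolutely convergent series of the multiplicative function
`meanCoeff f k`, to which the Euler product formula applies. -/
theorem hasProd_localFactor {f : ArithmeticFunction ℂ} (hf : ClassA 0 f) (k : ℕ) :
    HasProd (fun p : Nat.Primes => localFactor f k p)
      (∑' d : Fin k → ℕ, tupleMoebius (lcmFun f k) d * (1 / ((∏ i, d i : ℕ) : ℂ))) := by
  have hmult := hf.isMultiplicative
  have hsum : Summable fun d : Fin k → ℕ =>
      tupleMoebius (lcmFun f k) d * (1 / ((∏ i, d i : ℕ) : ℂ)) := by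
    refine Summable.of_norm ((summable_tupleMoebius hf (k := k) (s := 1) (by norm_num)).congr ?_)
    intro d
    rw [norm_mul, norm_div, norm_one, Complex.norm_natCast, Real.rpow_neg_one, one_div]
  have htsum : HasSum (meanCoeff f k)
      (∑' d : Fin k → ℕ, tupleMoebius (lcmFun f k) d * (1 / ((∏ i, d i : ℕ) : ℂ))) := by
    refine hasSum_sum_of_fiber hsum.hasSum (fun d => ∏ i, d i) (Nat.finMulAntidiag k)
      (fun n d hd => Nat.prod_eq_of_mem_finMulAntidiag hd) fun d hd => ?_
    refine Nat.mem_finMulAntidiag.2 ⟨rfl, prod_ne_zero_iff.2 fun i _ hi => hd ?_⟩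
    rw [tupleMoebius_eq_zero _ hi, zero_mul]
  have hnorm : Summable fun n => ‖meanCoeff f k n‖ := by
    refine Summable.of_nonneg_of_le (fun n => norm_nonneg _) (fun n => ?_)
      (summable_absCoeff hf k (s := 1) (by norm_num))
    rw [meanCoeff_eq, norm_mul, norm_div, norm_one, Complex.norm_natCast, Real.rpow_neg_one, one_div]
    gcongr
    exact norm_sum_le _ _
  have h := EulerProduct.eulerProduct_hasProd (f := meanCoeff f k) ?_ ?_ hnorm ?_
  · rw [htsum.tsum_eq] at h
    refine h.congr_fun fun p => ?_
    exact (hasSum_meanCoeff_prime_pow hf k p.2).tsum_eq.symm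
  · rw [meanCoeff_eq, Nat.finMulAntidiag_one, sum_singleton, tupleMoebius_one, lcmFun_one hmult]
    simp
  · intro m n hmn
    rw [meanCoeff_eq, meanCoeff_eq, meanCoeff_eq,
      (tupleMultiplicative_tupleMoebius_lcmFun hmult k).sum_finMulAntidiag hmn, Nat.cast_mul]
    ring
  · simp [meanCoeff]


/-! ### Lattice points in ellipsoids, by volume comparison. -/

theorem ballVolume_nonneg (k : ℕ) : 0 ≤ ballVolume k :=
  div_nonneg (Real.rpow_nonneg Real.pi_pos.le _) (Real.Gamma_pos_of_pos (by positivity)).le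

theorem volume_sum_sq_le {k : ℕ} (hk : k ≠ 0) {x : ℝ} (hx : 0 ≤ x) :
    volume {t : Fin k → ℝ | ∑ i, t i ^ 2 ≤ x} = ENNReal.ofReal (ballVolume k * √x ^ k) := by
  have : Nonempty (Fin k) := ⟨⟨0, Nat.pos_of_ne_zero hk⟩⟩
  have h := volume_sum_rpow_le (Fin k) (p := 2) (by norm_num) (√x)
  have hset : {t : Fin k → ℝ | (∑ i, |t i| ^ (2 : ℝ)) ^ (1 / 2 : ℝ) ≤ √x} =
      {t : Fin k → ℝ | ∑ i, t i ^ 2 ≤ x} := by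
    ext t
    simp only [Set.mem_ofPred_eq, Real.rpow_two, sq_abs]
    rw [← Real.sqrt_eq_rpow, Real.sqrt_le_sqrt_iff hx]
  have hG : 2 * Real.Gamma (1 / 2 + 1) = √Real.pi := by
    rw [Real.Gamma_add_one (by norm_num), Real.Gamma_one_half_eq]
    ring
  rw [hset, hG, Fintype.card_fin] at h
  have hV : √Real.pi ^ k / Real.Gamma ((k : ℝ) / 2 + 1) = ballVolume k := by
    rw [ballVolume, Real.sqrt_eq_rpow, ← Real.rpow_natCast, ← Real.rpow_mul Real.pi_pos.le]
    congr 2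
    ring
  rw [h, hV, ENNReal.ofReal_mul (ballVolume_nonneg k), ENNReal.ofReal_pow (Real.sqrt_nonneg x),
    mul_comm]

/-- The points whose coordinates have absolute values in `[dᵢ mᵢ, dᵢ (mᵢ + 1))`. -/
def absCell {k : ℕ} (d m : Fin k → ℕ) : Set (Fin k → ℝ) :=
  Set.univ.pi fun i => {t : ℝ | (d i : ℝ) * m i ≤ |t| ∧ |t| < d i * (m i + 1)}

theorem setOf_le_abs_lt (a b : ℝ) :
    {t : ℝ | a ≤ |t| ∧ |t| < b} = Set.Ioo (-b) b \ Set.Ioo (-a) a := by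
  ext t
  simp only [Set.mem_ofPred_eq, Set.mem_sdiff, Set.mem_Ioo, ← abs_lt, not_lt]
  exact and_comm

theorem measurableSet_absCell {k : ℕ} (d m : Fin k → ℕ) : MeasurableSet (absCell d m) := by
  refine MeasurableSet.univ_pi fun i => ?_
  rw [setOf_le_abs_lt]
  exact measurableSet_Ioo.diff measurableSet_Ioo

/-- Using `|t|` gives each coordinate set length `2 dᵢ`, also at `mᵢ = 0`, so non-negative `m` alone
tile the whole space. -/
theorem volume_absCell {k : ℕ} (d m : Fin k → ℕ) :
    volume (absCell d m) = ENNReal.ofReal (∏ i, 2 * (d i : ℝ)) := by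
  rw [absCell, volume_pi_pi, ENNReal.ofReal_prod_of_nonneg fun i _ => by positivity]
  refine prod_congr rfl fun i _ => ?_
  have hle : (d i : ℝ) * m i ≤ d i * (m i + 1) := by gcongr; linarith
  rw [setOf_le_abs_lt, measure_sdiff (Set.Ioo_subset_Ioo (by linarith) hle)
    measurableSet_Ioo.nullMeasurableSet (by simp), Real.volume_Ioo, Real.volume_Ioo,
    ← ENNReal.ofReal_sub _ (by have : (0 : ℝ) ≤ d i * m i := by positivity
                               linarith)]
  congr 1
  ring

theorem eq_floor_of_mem_absCell {k : ℕ} {d m : Fin k → ℕ} (hd : ∀ i, 0 < d i) {t : Fin k → ℝ}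
    (ht : t ∈ absCell d m) (i : Fin k) : m i = ⌊|t i| / d i⌋₊ := by
  have hdi : (0 : ℝ) < d i := by exact_mod_cast hd i
  obtain ⟨h1, h2⟩ := ht i (Set.mem_univ i)
  refine ((Nat.floor_eq_iff (by positivity)).2 ⟨?_, ?_⟩).symm
  · rw [le_div_iff₀ hdi]
    linarith
  · rw [div_lt_iff₀ hdi]
    linarith

theorem volume_biUnion_absCell {k : ℕ} {d : Fin k → ℕ} (hd : ∀ i, 0 < d i)
    (A : Finset (Fin k → ℕ)) :
    volume (⋃ m ∈ A, absCell d m) = ENNReal.ofReal (#A * ∏ i, 2 * (d i : ℝ)) := by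
  rw [measure_biUnion_finset (fun m _ n _ hmn => Set.disjoint_left.2 fun t hm hn => hmn ?_)
    fun m _ => measurableSet_absCell d m]
  · rw [sum_congr rfl fun m _ => volume_absCell d m, sum_const, nsmul_eq_mul,
      ENNReal.ofReal_mul (by positivity), ENNReal.ofReal_natCast]
  · funext i
    rw [eq_floor_of_mem_absCell hd hm, eq_floor_of_mem_absCell hd hn]

/-- The `k`-tuples of non-negative integers `m` with `∑ (dᵢ mᵢ)² ≤ x`. -/
noncomputable def ellipsoidPoints {k : ℕ} (x : ℝ) (d : Fin k → ℕ) : Finset (Fin k → ℕ) :=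
  {m ∈ Fintype.piFinset fun i => range (⌊√x / d i⌋₊ + 1) | ∑ i, ((d i : ℝ) * m i) ^ 2 ≤ x}

theorem mem_ellipsoidPoints {k : ℕ} {x : ℝ} {d m : Fin k → ℕ} (hd : ∀ i, 0 < d i) :
    m ∈ ellipsoidPoints x d ↔ ∑ i, ((d i : ℝ) * m i) ^ 2 ≤ x := by
  simp only [ellipsoidPoints, mem_filter, Fintype.mem_piFinset, mem_range, and_iff_right_iff_imp]
  intro h i
  have hdi : (0 : ℝ) < d i := by exact_mod_cast hd i
  refine Nat.lt_succ_of_le (Nat.le_floor ?_)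
  rw [le_div_iff₀ hdi, mul_comm]
  refine Real.le_sqrt_of_sq_le (le_trans ?_ h)
  exact single_le_sum (f := fun i => ((d i : ℝ) * m i) ^ 2) (fun j _ => sq_nonneg _) (mem_univ i)

/-- The number of spherical points with all coordinates divisible by those of `d`. -/
noncomputable def divCount {k : ℕ} (x : ℝ) (d : Fin k → ℕ) : ℕ :=
  #{n ∈ sphericalPoints k x | ∀ i, d i ∣ n i}

theorem divCount_eq {k : ℕ} {x : ℝ} {d : Fin k → ℕ} (hd : ∀ i, 0 < d i) :
    divCount x d = #{m ∈ ellipsoidPoints x d | ∀ i, 1 ≤ m i} := by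
  refine (card_nbij (fun m => d * m) ?_ ?_ ?_).symm
  · intro m hm
    rw [mem_coe, mem_filter, mem_ellipsoidPoints hd] at hm
    rw [mem_coe, mem_filter, mem_sphericalPoints]
    refine ⟨⟨fun i => Nat.mul_pos (hd i) (hm.2 i), ?_⟩, fun i => dvd_mul_right _ _⟩
    simpa using hm.1
  · intro m _ m' _ h
    exact funext fun i => Nat.eq_of_mul_eq_mul_left (hd i) (congrFun h i)
  · intro n hn
    rw [mem_coe, mem_filter, mem_sphericalPoints] at hn
    choose m hm using hn.2
    refine ⟨m, ?_, funext fun i => (hm i).symm⟩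
    rw [mem_coe, mem_filter, mem_ellipsoidPoints hd]
    refine ⟨?_, fun i => Nat.pos_of_mul_pos_left (hm i ▸ hn.1.1 i)⟩
    refine le_trans (le_of_eq (sum_congr rfl fun i _ => ?_)) hn.1.2
    rw [hm i, Nat.cast_mul]

/-- Attach to each positive `m` the cell of `m - 1`, whose outer corner is `d * m`; these disjoint
cells lie in the ball. -/
theorem divCount_mul_le {k : ℕ} (hk : k ≠ 0) {x : ℝ} (hx : 0 ≤ x) {d : Fin k → ℕ}
    (hd : ∀ i, 0 < d i) :
    divCount x d * ∏ i, 2 * (d i : ℝ) ≤ ballVolume k * √x ^ k := by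
  have hinj : Set.InjOn (fun (m : Fin k → ℕ) i => m i - 1)
      ({m ∈ ellipsoidPoints x d | ∀ i, 1 ≤ m i} : Finset (Fin k → ℕ)) := by
    intro m hm n hn h
    rw [mem_coe, mem_filter] at hm hn
    funext i
    have h1 := hm.2 i
    have h2 := hn.2 i
    have h3 : m i - 1 = n i - 1 := congrFun h i
    lia
  rw [← ENNReal.ofReal_le_ofReal_iff (mul_nonneg (ballVolume_nonneg k) (by positivity)),
    ← volume_sum_sq_le hk hx, divCount_eq hd, ← card_image_of_injOn hinj,
    ← volume_biUnion_absCell hd]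
  refine measure_mono fun t ht => ?_
  simp only [Set.mem_iUnion, mem_image, mem_filter, exists_prop] at ht
  obtain ⟨_, ⟨m, ⟨hm, hm1⟩, rfl⟩, htm⟩ := ht
  rw [mem_ellipsoidPoints hd] at hm
  refine le_trans (sum_le_sum fun i _ => ?_) hm
  obtain ⟨-, h2⟩ := htm i (Set.mem_univ i)
  rw [Nat.cast_sub (hm1 i), Nat.cast_one, sub_add_cancel] at h2
  rw [← sq_abs]
  exact pow_le_pow_left₀ (abs_nonneg _) h2.le 2

/-- Each point of the ball lies in a cell whose inner corner is also in the ball, so these cells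
cover it. -/
theorem le_card_ellipsoidPoints_mul {k : ℕ} (hk : k ≠ 0) {x : ℝ} (hx : 0 ≤ x) {d : Fin k → ℕ}
    (hd : ∀ i, 0 < d i) :
    ballVolume k * √x ^ k ≤ #(ellipsoidPoints x d) * ∏ i, 2 * (d i : ℝ) := by
  rw [← ENNReal.ofReal_le_ofReal_iff (by positivity), ← volume_sum_sq_le hk hx,
    ← volume_biUnion_absCell hd]
  refine measure_mono fun t ht => ?_
  have hfl : ∀ i, (d i : ℝ) * ⌊|t i| / d i⌋₊ ≤ |t i| := fun i => by
    have hdi : (0 : ℝ) < d i := by exact_mod_cast hd i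
    have := Nat.floor_le (show 0 ≤ |t i| / d i by positivity)
    rwa [le_div_iff₀ hdi, mul_comm] at this
  simp only [Set.mem_iUnion, exists_prop]
  refine ⟨fun i => ⌊|t i| / d i⌋₊, (mem_ellipsoidPoints hd).2 ?_, fun i _ => ⟨hfl i, ?_⟩⟩
  · refine le_trans (sum_le_sum fun i _ => ?_) ht
    rw [← sq_abs (t i)]
    exact pow_le_pow_left₀ (by positivity) (hfl i) 2
  · have hdi : (0 : ℝ) < d i := by exact_mod_cast hd i
    have := Nat.lt_floor_add_one (|t i| / d i)
    rwa [div_lt_iff₀ hdi, mul_comm] at this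

/-- The excess consists of points with a zero coordinate. Each coordinate has at most `2√x / dⱼ`
values since `dⱼ ≤ √x`, and fixing the `i`-th one saves a factor `dᵢ / √x`. -/
theorem card_ellipsoidPoints_le {k : ℕ} {x : ℝ} {d : Fin k → ℕ} (hd : ∀ i, 0 < d i)
    (hdx : ∀ i, (d i : ℝ) ≤ √x) :
    (#(ellipsoidPoints x d) : ℝ) ≤
      divCount x d + (∏ i, 2 * (√x / d i)) * ∑ i, d i / √x := by
  have hd' : ∀ i, (0 : ℝ) < d i := fun i => by exact_mod_cast hd i
  have hone : ∀ i, 1 ≤ √x / d i := fun i => by rw [one_le_div (hd' i)]; exact hdx i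
  set E := fun i : Fin k => Fintype.piFinset fun j =>
    if j = i then {0} else range (⌊√x / d j⌋₊ + 1) with hE
  have hsub : ellipsoidPoints x d ⊆
      {m ∈ ellipsoidPoints x d | ∀ i, 1 ≤ m i} ∪ univ.biUnion E := by
    intro m hm
    by_cases h : ∀ i, 1 ≤ m i
    · exact mem_union_left _ (mem_filter.2 ⟨hm, h⟩)
    · push Not at h
      obtain ⟨i, hi⟩ := h
      refine mem_union_right _ (mem_biUnion.2 ⟨i, mem_univ i, Fintype.mem_piFinset.2 fun j => ?_⟩)
      split_ifs with hj
      · subst hj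
        rw [mem_singleton]
        lia
      · exact Fintype.mem_piFinset.1 (mem_filter.1 hm).1 j
  have hcard : ∀ i, (#(E i) : ℝ) ≤ (∏ j, 2 * (√x / d j)) * (d i / √x) := by
    intro i
    rw [hE, Fintype.card_piFinset, Nat.cast_prod,
      ← Fintype.prod_ite_eq' i (fun i => (d i : ℝ) / √x), ← prod_mul_distrib]
    refine prod_le_prod (fun j _ => by positivity) fun j _ => ?_
    have hj := hone j
    split_ifs with h
    · subst h
      have h0 : (d j : ℝ) ≠ 0 := (hd' j).ne'
      have h1 : √x ≠ 0 := ((hd' j).trans_le (hdx j)).ne'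
      rw [card_singleton, Nat.cast_one, mul_assoc, div_mul_div_cancel₀ h0, div_self h1]
      norm_num
    · rw [card_range, Nat.cast_add, Nat.cast_one, mul_one]
      linarith [Nat.floor_le (zero_le_one.trans hj)]
  calc (#(ellipsoidPoints x d) : ℝ)
      ≤ ((#{m ∈ ellipsoidPoints x d | ∀ i, 1 ≤ m i} + ∑ i, #(E i) : ℕ) : ℝ) := by
        exact_mod_cast (card_le_card hsub).trans
          ((card_union_le _ _).trans (Nat.add_le_add_left card_biUnion_le _))
    _ ≤ _ := by
        rw [← divCount_eq hd, Nat.cast_add, Nat.cast_sum, mul_sum]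
        gcongr with i
        exact hcard i

theorem divCount_eq_zero {k : ℕ} {x : ℝ} {d : Fin k → ℕ} {i : Fin k} (hi : √x < d i) :
    divCount x d = 0 := by
  rw [divCount, card_eq_zero]
  refine filter_eq_empty_iff.2 fun n hn h => ?_
  rw [mem_sphericalPoints] at hn
  have h1 : (d i : ℝ) ≤ n i := by exact_mod_cast Nat.le_of_dvd (hn.1 i) (h i)
  have h2 : (n i : ℝ) ≤ √x := Real.le_sqrt_of_sq_le
    ((single_le_sum (f := fun j => (n j : ℝ) ^ 2) (fun j _ => sq_nonneg _) (mem_univ i)).trans hn.2)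
  linarith

/-- The exponent `θ` makes the bound uniform in `d`. If all `dᵢ ≤ √x`, then `dᵢ / √x` is at most its
`θ`-th power; otherwise the count is `0` and some `(dᵢ / √x) ^ θ ≥ 1` absorbs the main term. -/
theorem abs_divCount_mul_sub_le {k : ℕ} (hk : k ≠ 0) {x : ℝ} (hx : 0 < x) {d : Fin k → ℕ}
    (hd : ∀ i, 0 < d i) {θ : ℝ} (hθ0 : 0 ≤ θ) (hθ1 : θ ≤ 1) :
    |divCount x d * ∏ i, 2 * (d i : ℝ) - ballVolume k * √x ^ k| ≤
      (ballVolume k + 4 ^ k) * √x ^ k * ∑ i, (d i / √x) ^ θ := by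
  have hV := ballVolume_nonneg k
  have hX : 0 < √x := Real.sqrt_pos.2 hx
  have hd' : ∀ i, (0 : ℝ) < d i := fun i => by exact_mod_cast hd i
  have hle := divCount_mul_le hk hx.le hd
  rw [abs_of_nonpos (by linarith), neg_sub]
  by_cases h : ∀ i, (d i : ℝ) ≤ √x
  · have h1 := le_card_ellipsoidPoints_mul hk hx.le hd
    have h2 := mul_le_mul_of_nonneg_right (card_ellipsoidPoints_le hd h)
      (show 0 ≤ ∏ i, 2 * (d i : ℝ) by positivity)
    have h3 : (∏ i, 2 * (√x / d i)) * ∏ i, 2 * (d i : ℝ) = 4 ^ k * √x ^ k := by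
      rw [← prod_mul_distrib, ← mul_pow]
      have : ∀ i, 2 * (√x / d i) * (2 * (d i : ℝ)) = 4 * √x := fun i => by
        have := (hd' i).ne'
        field_simp
        norm_num
      simp [this]
    have h4 : ∑ i, d i / √x ≤ ∑ i, (d i / √x) ^ θ := by
      refine sum_le_sum fun i _ => ?_
      refine Real.self_le_rpow_of_le_one (by have := hd' i; positivity) ?_ hθ1
      exact (div_le_one hX).2 (h i)
    calc _ ≤ 4 ^ k * √x ^ k * ∑ i, d i / √x := by
          rw [← h3]
          linarith
      _ ≤ (ballVolume k + 4 ^ k) * √x ^ k * ∑ i, (d i / √x) ^ θ := by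
          gcongr
          linarith
  · push Not at h
    obtain ⟨i, hi⟩ := h
    rw [divCount_eq_zero hi, Nat.cast_zero, zero_mul, sub_zero]
    have h1 : 1 ≤ ∑ i, (d i / √x) ^ θ := by
      refine le_trans (Real.one_le_rpow ((one_le_div hX).2 hi.le) hθ0)
        (single_le_sum (f := fun i => ((d i : ℝ) / √x) ^ θ) (fun j _ => by positivity)
          (mem_univ i))
    calc ballVolume k * √x ^ k = ballVolume k * √x ^ k * 1 := (mul_one _).symm
      _ ≤ (ballVolume k + 4 ^ k) * √x ^ k * ∑ i, (d i / √x) ^ θ := by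
          gcongr
          linarith [show (0 : ℝ) ≤ 4 ^ k by positivity]

theorem abs_divCount_sub_le {k : ℕ} (hk : k ≠ 0) {x : ℝ} (hx : 0 < x) {d : Fin k → ℕ}
    (hd : ∀ i, 0 < d i) {θ : ℝ} (hθ0 : 0 ≤ θ) (hθ1 : θ ≤ 1) :
    |divCount x d - ballVolume k * √x ^ k / 2 ^ k * (1 / ((∏ i, d i : ℕ) : ℝ))| ≤
      (ballVolume k + 4 ^ k) * k * (√x ^ k * √x ^ (-θ)) * ((∏ i, d i : ℕ) : ℝ) ^ (-(1 - θ)) := by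
  have hV := ballVolume_nonneg k
  have hX : 0 < √x := Real.sqrt_pos.2 hx
  set P : ℝ := ((∏ i, d i : ℕ) : ℝ) with hP
  have hP0 : 0 < P := by
    rw [hP]
    exact_mod_cast prod_pos fun i _ => hd i
  have h := abs_divCount_mul_sub_le hk hx hd hθ0 hθ1
  have hprod : ∏ i, 2 * (d i : ℝ) = 2 ^ k * P := by
    rw [prod_mul_distrib, hP]
    simp
  have hsum : ∑ i, (d i / √x) ^ θ ≤ k * (P ^ θ * √x ^ (-θ)) := by
    have : ∀ i ∈ (univ : Finset (Fin k)), ((d i : ℝ) / √x) ^ θ ≤ P ^ θ * √x ^ (-θ) := by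
      intro i _
      rw [Real.div_rpow (by positivity) hX.le, Real.rpow_neg hX.le, div_eq_mul_inv]
      gcongr
      rw [hP]
      exact_mod_cast Nat.le_of_dvd (prod_pos fun i _ => hd i) (dvd_prod_of_mem d (mem_univ i))
    simpa using sum_le_card_nsmul _ _ _ this
  have h2 : (divCount x d : ℝ) - ballVolume k * √x ^ k / 2 ^ k * (1 / P) =
      (divCount x d * ∏ i, 2 * (d i : ℝ) - ballVolume k * √x ^ k) / (2 ^ k * P) := by
    rw [hprod]
    field_simp
  have h3 : P ^ (-(1 - θ)) = P ^ θ / P := by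
    rw [neg_sub, Real.rpow_sub_one hP0.ne']
  rw [h2, abs_div, abs_of_pos (show 0 < 2 ^ k * P by positivity), h3, div_le_iff₀ (by positivity)]
  calc _ ≤ (ballVolume k + 4 ^ k) * √x ^ k * (k * (P ^ θ * √x ^ (-θ))) := by
        refine h.trans ?_
        gcongr
    _ = (ballVolume k + 4 ^ k) * k * (√x ^ k * √x ^ (-θ)) * (P ^ θ / P) * (1 * P) := by
        field_simp
    _ ≤ _ := by
        gcongr
        exact one_le_pow₀ (by norm_num)

/-! ### Summation over `d` and the asymptotic formula. -/

theorem hasSum_divCount {k : ℕ} (F : (Fin k → ℕ) → ℂ) (x : ℝ) :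
    HasSum (fun d => tupleMoebius F d * divCount x d) (∑ n ∈ sphericalPoints k x, F n) := by
  have h : ∀ n ∈ sphericalPoints k x,
      HasSum (fun d : Fin k → ℕ => if ∀ i, d i ∣ n i then tupleMoebius F d else 0) (F n) := by
    intro n hn
    have hn0 : ∀ i, n i ≠ 0 := fun i => Nat.one_le_iff_ne_zero.1 ((mem_sphericalPoints.1 hn).1 i)
    have h1 := hasSum_sum_of_ne_finset_zero (s := Fintype.piFinset fun i => (n i).divisors)
      (f := fun d : Fin k → ℕ => if ∀ i, d i ∣ n i then tupleMoebius F d else 0)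
      (L := SummationFilter.unconditional _) fun d hd =>
        if_neg fun h => hd (Fintype.mem_piFinset.2 fun i => Nat.mem_divisors.2 ⟨h i, hn0 i⟩)
    rw [sum_congr rfl fun d hd => if_pos fun i =>
      Nat.dvd_of_mem_divisors (Fintype.mem_piFinset.1 hd i), sum_tupleMoebius F hn0] at h1
    exact h1
  refine (hasSum_sum h).congr_fun fun d => ?_
  rw [← sum_filter, sum_const, nsmul_eq_mul, divCount, mul_comm]

theorem sqrt_pow_mul_rpow {x : ℝ} (hx : 0 < x) (k : ℕ) (ε : ℝ) :
    √x ^ k * √x ^ (-(1 / 2 - 2 * ε)) = x ^ ((k : ℝ) / 2 - 1 / 4 + ε) := by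
  rw [Real.sqrt_eq_rpow, ← Real.rpow_natCast, ← Real.rpow_mul hx.le, ← Real.rpow_mul hx.le,
    ← Real.rpow_add hx]
  congr 1
  ring

theorem exists_norm_sum_lcm_sub_le {k : ℕ} (hk : k ≠ 0) {f : ArithmeticFunction ℂ}
    (hf : ClassA 0 f) {ε : ℝ} (hε : 0 < ε) (hε' : ε ≤ 1 / 4) :
    ∃ C : ℝ, ∀ x : ℝ, 1 ≤ x →
      ‖∑ n ∈ sphericalPoints k x, f (univ.lcm n) -
          (ballVolume k : ℂ) * eulerConst f k / 2 ^ k * ((x ^ ((k : ℝ) / 2) : ℝ) : ℂ)‖ ≤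
        C * x ^ ((k : ℝ) / 2 - 1 / 4 + ε) := by
  -- Here `θ = 1/2 - 2ε`, so `s = 1 - θ = 1/2 + 2ε` exceeds `1/2`; `ε ≤ 1/4` keeps `θ ≥ 0`.
  have hS := summable_tupleMoebius hf (k := k) (s := 1 - (1 / 2 - 2 * ε)) (by linarith)
  set M := ∑' d : Fin k → ℕ,
    ‖tupleMoebius (lcmFun f k) d‖ * ((∏ i, d i : ℕ) : ℝ) ^ (-(1 - (1 / 2 - 2 * ε))) with hM
  refine ⟨(ballVolume k + 4 ^ k) * k * M, fun x hx => ?_⟩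
  have hx0 : 0 < x := by linarith
  have hsum : Summable fun d : Fin k → ℕ =>
      tupleMoebius (lcmFun f k) d * (1 / ((∏ i, d i : ℕ) : ℂ)) := by
    refine Summable.of_norm ((summable_tupleMoebius hf (k := k) (s := 1) (by norm_num)).congr ?_)
    intro d
    rw [norm_mul, norm_div, norm_one, Complex.norm_natCast, Real.rpow_neg_one, one_div]
  have hE := hsum.hasSum.mul_left ((ballVolume k * √x ^ k / 2 ^ k : ℝ) : ℂ)
  rw [← (hasProd_localFactor hf k).tprod_eq] at hE
  have hdiff := (hasSum_divCount (lcmFun f k) x).sub hE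
  have hbound := hdiff.norm_le_of_bounded
    (hS.hasSum.mul_left ((ballVolume k + 4 ^ k) * k * x ^ ((k : ℝ) / 2 - 1 / 4 + ε))) fun d => ?_
  · have hpow : √x ^ k = x ^ ((k : ℝ) / 2) := by
      rw [Real.sqrt_eq_rpow, ← Real.rpow_natCast, ← Real.rpow_mul hx0.le]
      congr 1
      ring
    rw [hpow] at hbound
    refine le_of_eq_of_le ?_ (hbound.trans_eq ?_)
    · rw [eulerConst]
      simp only [lcmFun]
      congr 2
      push_cast
      ring
    · rw [← hM]
      ring
  · by_cases hd : ∀ i, 0 < d i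
    · have h1 := abs_divCount_sub_le hk hx0 hd (θ := 1 / 2 - 2 * ε) (by linarith) (by linarith)
      rw [sqrt_pow_mul_rpow hx0] at h1
      have h2 : tupleMoebius (lcmFun f k) d * (divCount x d : ℂ) -
          ((ballVolume k * √x ^ k / 2 ^ k : ℝ) : ℂ) *
            (tupleMoebius (lcmFun f k) d * (1 / ((∏ i, d i : ℕ) : ℂ))) =
          tupleMoebius (lcmFun f k) d * ((divCount x d -
            ballVolume k * √x ^ k / 2 ^ k * (1 / ((∏ i, d i : ℕ) : ℝ)) : ℝ) : ℂ) := by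
        push_cast
        ring
      rw [h2, norm_mul, Complex.norm_real, Real.norm_eq_abs]
      calc _ ≤ ‖tupleMoebius (lcmFun f k) d‖ * _ := mul_le_mul_of_nonneg_left h1 (norm_nonneg _)
        _ = _ := by ring
    · push Not at hd
      obtain ⟨i, hi⟩ := hd
      rw [tupleMoebius_eq_zero _ (Nat.le_zero.1 hi)]
      simp

end SphericalLCM

theorem mainTheorem3 (k : ℕ) (hk : 2 ≤ k) (f : ArithmeticFunction ℂ)
    (hf : SphericalLCM.ClassA 0 f) :
    (∀ p : Nat.Primes, Summable (SphericalLCM.localTerm f k p)) ∧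
    Multipliable (fun p : Nat.Primes => SphericalLCM.localFactor f k p) ∧
    ∀ ε : ℝ, 0 < ε → ∃ C : ℝ, ∀ x : ℝ, 1 ≤ x →
      ‖∑ n ∈ SphericalLCM.sphericalPoints k x, f (Finset.univ.lcm n) -
          (SphericalLCM.ballVolume k : ℂ) * SphericalLCM.eulerConst f k / 2 ^ k *
            ((x ^ ((k : ℝ) / 2) : ℝ) : ℂ)‖ ≤
        C * x ^ ((k : ℝ) / 2 - 1 / 4 + ε) := by
  refine ⟨fun p => SphericalLCM.summable_localTerm hf k p.2,
    (SphericalLCM.hasProd_localFactor hf k).multipliable, fun ε hε => ?_⟩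
  -- Larger `ε` follow from `1/4` because `x ≥ 1`; `|C|` keeps the coefficient non-negative when the
  -- exponent grows.
  obtain ⟨C, hC⟩ := SphericalLCM.exists_norm_sum_lcm_sub_le (k := k) (by lia) hf
    (ε := min ε (1 / 4)) (by positivity) (min_le_right _ _)
  refine ⟨|C|, fun x hx => (hC x hx).trans ?_⟩
  have h := min_le_left ε (1 / 4)
  gcongr
  exact le_abs_self C
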